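/- Let $f(x)=x-\lfloor x\rfloor-\tfrac12$ and, for $n\ge 1$, $S_n(x)=\sum_{k=1}^n f(2^k x)$ for $x\in[0,1]$. Write $|\cdot|$ for Lebesgue measure, and regard $S_n$ as a random variable on $[0,1]$ with Lebesgue measure. (1) (Local limit theorem.) Let $y\in\mathbb R$, let $B\subset\mathbb R$ be Jordan measurable (bounded with Lebesgue-null boundary) with $|B|>0$, and let $\delta\in(0,\tfrac{13}{24})$. Then $$\lim_{n\to\infty}\Big(\frac{\sqrt n}{4}\Big)^{\delta}\,\Big|\Big\{x\in[0,1]:\ \frac{2S_n(x)}{\sqrt n}-y\in\Big(\frac{4}{\sqrt n}\Big)^{\delta}B\Big\}\Big|=\frac{e^{-y^2/2}\,|B|}{\sqrt{2\pi}} .$$ (2) (Speed of convergence.) There is a constant $C>0$ such that for all $n\ge1$ the Kolmogorov distance (the supremum distance of the distribution functions) satisfies $$d_{Kol}\Big(\frac{2S_n}{\sqrt n},\mathcal N(0,1)\Big)\le C\Big(\frac{4}{\sqrt n}\Big)^{13/24}.$$ (3) (Zone of control.) Let $X_n=S_n/n^{1/4}$, $t_n=\sqrt n/4$, $\gamma=\tfrac1{24}$,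 $v=2$, $w=4$. Then $(X_n)_{n\ge1}$ has the zone of control $[-Dt_n^\gamma,Dt_n^\gamma]$ with index $(v,w)$ for some $D>0$: there are constants $D,K_1,K_2>0$, independent of $n$, with $D\le (4K_2)^{-1/(w-2)}$, such that for all $n\ge1$ and all real $\lambda$ with $|\lambda|\le D\,t_n^{\gamma}$, $$\Big|\mathbb E\big[e^{i\lambda X_n}\big]\,e^{t_n\lambda^2/2}-1\Big|\le K_1|\lambda|^{v}e^{K_2|\lambda|^{w}} .$$ (The numerical conditions $w\ge2$ and $-\tfrac12\le\gamma\le\tfrac1{w-2}$ of a zone of control also hold.) -/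

import Mathlib

open MeasureTheory ProbabilityTheory Filter Topology
open scoped Pointwise

noncomputable section

/-- The function `f(x) = {x} - 1/2`. -/
def sawtooth (x : ℝ) : ℝ := x - (⌊x⌋ : ℝ) - 1 / 2

/-- `S_n(x) = ∑_{k=1}^n f(2^k x)` with `f(x) = {x} - 1/2`. -/
def sawtoothSum (n : ℕ) (x : ℝ) : ℝ := ∑ k ∈ Finset.Icc 1 n, sawtooth (2 ^ k * x)

/-- Lebesgue measure on `[0,1]`. -/
def unitMeasure : Measure ℝ := volume.restrict (Set.Icc (0 : ℝ) 1)

/-- A set of reals is Jordan measurable if it is bounded and its boundary is a null set. -/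
def IsJordanMeasurable (B : Set ℝ) : Prop :=
  Bornology.IsBounded B ∧ volume (frontier B) = 0

/-- Kolmogorov distance of two probability measures on `ℝ`:
the supremum distance of their distribution functions. -/
def kolmogorovDist (μ ν : Measure ℝ) : ℝ :=
  ⨆ s : ℝ, |μ.real (Set.Iic s) - ν.real (Set.Iic s)|

/-- The real random variables `X_1, X_2, …` have, for the parameters `t_n → ∞`, a zone of control
`[-D t_n^γ, D t_n^γ]` with index `(v, w)`. The restrictions `γ ≤ 1 / (w - 2)` and
`D ≤ (1 / (4 K₂)) ^ (1 / (w - 2))` are written without the division by `w - 2`, so that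
nothing is divided by zero for `w = 2`. -/
def HasZoneOfControl {Ω : Type*} [MeasurableSpace Ω] (P : Measure Ω) (X : ℕ → Ω → ℝ)
    (t : ℕ → ℝ) (γ v w : ℝ) : Prop :=
  Tendsto t atTop atTop ∧ 0 < v ∧ 2 ≤ w ∧ -(1 / 2) ≤ γ ∧ γ * (w - 2) ≤ 1 ∧
  ∃ D K₁ K₂ : ℝ, 0 < D ∧ 0 < K₁ ∧ 0 < K₂ ∧ D ^ (w - 2) ≤ 1 / (4 * K₂) ∧
    ∀ n : ℕ, 1 ≤ n → ∀ l : ℝ, |l| ≤ D * t n ^ γ →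
      ‖(∫ ω, Complex.exp (Complex.I * ((l * X n ω : ℝ) : ℂ)) ∂P) *
          ((Real.exp (t n * l ^ 2 / 2) : ℝ) : ℂ) - 1‖
        ≤ K₁ * |l| ^ v * Real.exp (K₂ * |l| ^ w)

end

/-! The function `2 f(x) - f(2x)` is `±1/2` according to the first binary digit of `x`. Summing it
along the orbit of the doubling map telescopes (`binaryWalk_eq`), so `S_n` is a symmetric random
walk with steps `±1/2` up to a bounded error. The variance is asymptotically `n/4`, which explains
the scaling `2 S_n / √n`.

The Kolmogorov bound comes from Stein's method. Replacing the last step of the walk by a uniform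
variable on `[-1/2, 1/2]` gives a zero bias partner (`integral_binaryWalk_mul_eq_zeroBias`), and
that uniform variable is `f(2^m x)`. The Stein equation is evaluated at the partner, so the
indicator is never compared at two different points and no concentration estimate is needed
(`abs_zeroBiasWalk_cdf_sub_le`). Since `S_n` stays within distance `2` of the partner, it inherits
the rate `n^(-1/2)`, which is stronger than the exponent `13/24` asks for.

The local limit theorem follows from this rate: an error of order `4/√n` is negligible in a window
of size `(4/√n)^δ` for every `δ < 1`. This gives half-open intervals (`tendsto_window_Ioc`), and
approximation from inside and outside gives Jordan measurable sets (`tendsto_of_tendsto_Ioc`).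

The zone of control rests on an exact formula: halving the unit interval turns the characteristic
function of `S_n` into a product of cosines and one bounded correction (`sawtoothCharFun_eq_prod`).
Each cosine is compared with `exp (-l^2 / 8)`; the errors are summable up to the quartic term. -/

/-! ### The sawtooth function, its sums, and integrals over the unit interval -/

theorem sawtooth_add_one (x : ℝ) : sawtooth (x + 1) = sawtooth x := by
  simp [sawtooth]

theorem sawtooth_of_mem_Ico {x : ℝ} (h0 : 0 ≤ x) (h1 : x < 1) : sawtooth x = x - 1 / 2 := by
  have : ⌊x⌋ = 0 := Int.floor_eq_zero_iff.2 ⟨h0, h1⟩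
  simp [sawtooth, this]

theorem abs_sawtooth_le (x : ℝ) : |sawtooth x| ≤ 1 / 2 := by
  have h0 := Int.floor_le x
  have h1 := Int.lt_floor_add_one x
  rw [abs_le]; constructor <;> simp only [sawtooth] <;> linarith

@[fun_prop]
theorem measurable_sawtooth : Measurable sawtooth := by
  unfold sawtooth; fun_prop

@[fun_prop]
theorem measurable_sawtoothSum (n : ℕ) : Measurable (sawtoothSum n) := by
  unfold sawtoothSum; fun_prop

theorem sawtooth_add_nat (x : ℝ) (m : ℕ) : sawtooth (x + m) = sawtooth x := by
  simp [sawtooth]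

theorem sawtoothSum_add_one (n : ℕ) (x : ℝ) : sawtoothSum n (x + 1) = sawtoothSum n x := by
  refine Finset.sum_congr rfl fun k _ => ?_
  have := sawtooth_add_nat (2 ^ k * x) (2 ^ k)
  push_cast at this
  rw [← this]; ring_nf

theorem sawtoothSum_zero (x : ℝ) : sawtoothSum 0 x = 0 := by simp [sawtoothSum]

theorem sawtoothSum_succ (n : ℕ) (x : ℝ) :
    sawtoothSum (n + 1) x = sawtoothSum n x + sawtooth (2 ^ (n + 1) * x) := by
  simp [sawtoothSum, Finset.sum_Icc_succ_top]

theorem sawtoothSum_succ' (n : ℕ) (x : ℝ) :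
    sawtoothSum (n + 1) x = sawtooth (2 * x) + sawtoothSum n (2 * x) := by
  induction n with
  | zero => simp [sawtoothSum]
  | succ n ih =>
    rw [sawtoothSum_succ, ih, sawtoothSum_succ, add_assoc]
    congr 3; ring

/-- The integral over the unit interval, split into its two halves. -/
theorem intervalIntegral_unit_eq_halves {E : Type*} [NormedAddCommGroup E] [NormedSpace ℝ E]
    {k : ℝ → E} (hk : IntervalIntegrable k volume 0 1) :
    ∫ x in (0 : ℝ)..1, k x =
      (1 / 2 : ℝ) • (∫ u in (0 : ℝ)..1, k (u / 2)) +
        (1 / 2 : ℝ) • ∫ u in (0 : ℝ)..1, k ((u + 1) / 2) := by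
  have e1 : ∫ u in (0 : ℝ)..1, k (u / 2) = (2 : ℝ) • ∫ x in (0 : ℝ)..(1 / 2), k x := by
    rw [intervalIntegral.integral_comp_div k two_ne_zero]; simp
  have e2 : ∫ u in (0 : ℝ)..1, k ((u + 1) / 2) = (2 : ℝ) • ∫ x in (1 / 2 : ℝ)..1, k x := by
    have h : ∀ u : ℝ, (u + 1) / 2 = u / 2 + 1 / 2 := fun u => by ring
    simp_rw [h]
    rw [intervalIntegral.integral_comp_div_add k two_ne_zero]; norm_num
  have hsub : ∀ a b : ℝ, 0 ≤ a → a ≤ 1 → 0 ≤ b → b ≤ 1 → IntervalIntegrable k volume a b := by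
    intro a b ha ha' hb hb'
    refine hk.mono_set ?_
    rw [Set.uIcc_of_le zero_le_one]
    exact Set.uIcc_subset_Icc ⟨ha, ha'⟩ ⟨hb, hb'⟩
  rw [e1, e2, smul_smul, smul_smul]
  norm_num
  rw [intervalIntegral.integral_add_adjacent_intervals] <;> apply hsub <;> norm_num

theorem integral_unitMeasure {E : Type*} [NormedAddCommGroup E] [NormedSpace ℝ E] (k : ℝ → E) :
    ∫ x, k x ∂unitMeasure = ∫ x in (0 : ℝ)..1, k x := by
  rw [unitMeasure, intervalIntegral.integral_of_le zero_le_one, integral_Icc_eq_integral_Ioc]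

instance : IsProbabilityMeasure unitMeasure := ⟨by simp [unitMeasure]⟩

theorem intervalIntegrable_of_measurable_of_bounded {E : Type*} [NormedAddCommGroup E]
    [MeasurableSpace E] [BorelSpace E] [SecondCountableTopology E] {k : ℝ → E} (hk : Measurable k)
    {C : ℝ} (hC : ∀ x, ‖k x‖ ≤ C) (a b : ℝ) : IntervalIntegrable k volume a b := by
  rw [intervalIntegrable_iff]
  exact Measure.integrableOn_of_bounded (by simp) hk.aestronglyMeasurable
    (Eventually.of_forall hC)

/-- Two integrands that agree on `[0, 1)` have the same integral over the unit interval. -/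
theorem intervalIntegral_unit_congr {E : Type*} [NormedAddCommGroup E] [NormedSpace ℝ E]
    {k l : ℝ → E} (h : ∀ x, 0 ≤ x → x < 1 → k x = l x) :
    ∫ x in (0 : ℝ)..1, k x = ∫ x in (0 : ℝ)..1, l x := by
  rw [intervalIntegral.integral_of_le zero_le_one, intervalIntegral.integral_of_le zero_le_one,
    ← integral_Ico_eq_integral_Ioc, ← integral_Ico_eq_integral_Ioc]
  exact setIntegral_congr_fun measurableSet_Ico fun x hx => h x hx.1 hx.2

/-! ### The binary digits -/

/-- The first binary digit of `x`, with values `-1/2` and `1/2`. -/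
noncomputable def binaryStep (x : ℝ) : ℝ := 2 * sawtooth x - sawtooth (2 * x)

/-- The random walk of the first `n` binary digits. -/
noncomputable def binaryWalk (n : ℕ) (x : ℝ) : ℝ := ∑ k ∈ Finset.range n, binaryStep (2 ^ k * x)

theorem sawtooth_two_mul_add_one (u : ℝ) : sawtooth (2 * ((u + 1) / 2)) = sawtooth u := by
  rw [← sawtooth_add_one u]; congr 1; ring

theorem sawtooth_half {u : ℝ} (h0 : 0 ≤ u) (h1 : u < 1) :
    sawtooth (u / 2) = sawtooth u / 2 - 1 / 4 := by
  rw [sawtooth_of_mem_Ico h0 h1, sawtooth_of_mem_Ico (by linarith) (by linarith)]; ring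

theorem sawtooth_half_add_half {u : ℝ} (h0 : 0 ≤ u) (h1 : u < 1) :
    sawtooth ((u + 1) / 2) = sawtooth u / 2 + 1 / 4 := by
  rw [sawtooth_of_mem_Ico h0 h1, sawtooth_of_mem_Ico (by linarith) (by linarith)]; ring

theorem binaryStep_half {u : ℝ} (h0 : 0 ≤ u) (h1 : u < 1) : binaryStep (u / 2) = -(1 / 2) := by
  rw [binaryStep, sawtooth_half h0 h1, mul_div_cancel₀ u two_ne_zero]; ring

theorem binaryStep_half_add_half {u : ℝ} (h0 : 0 ≤ u) (h1 : u < 1) :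
    binaryStep ((u + 1) / 2) = 1 / 2 := by
  rw [binaryStep, sawtooth_half_add_half h0 h1, sawtooth_two_mul_add_one]; ring

/-- A crude bound, enough for the integrability of functions of the walk. -/
theorem abs_binaryStep_le (x : ℝ) : |binaryStep x| ≤ 2 := by
  have h1 := abs_le.1 (abs_sawtooth_le x)
  have h2 := abs_le.1 (abs_sawtooth_le (2 * x))
  rw [abs_le, binaryStep]; constructor <;> linarith

theorem abs_binaryWalk_le (n : ℕ) (x : ℝ) : |binaryWalk n x| ≤ 2 * n := by
  refine (Finset.abs_sum_le_sum_abs _ _).trans ?_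
  refine (Finset.sum_le_sum fun k _ => abs_binaryStep_le _).trans ?_
  simp [mul_comm]

@[fun_prop]
theorem measurable_binaryWalk (n : ℕ) : Measurable (binaryWalk n) := by
  unfold binaryWalk binaryStep; fun_prop

theorem binaryWalk_succ (n : ℕ) (x : ℝ) :
    binaryWalk (n + 1) x = binaryWalk n x + binaryStep (2 ^ n * x) := Finset.sum_range_succ _ _

theorem binaryWalk_succ' (n : ℕ) (x : ℝ) :
    binaryWalk (n + 1) x = binaryStep x + binaryWalk n (2 * x) := by
  rw [binaryWalk, Finset.sum_range_succ', add_comm, binaryWalk]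
  simp [pow_succ, mul_assoc]

/-- Telescoping of `2 f(2^k x) - f(2^(k+1) x)`: `S_n` differs from the walk only by boundary terms
at the two ends of the orbit. -/
theorem binaryWalk_eq (n : ℕ) (x : ℝ) :
    binaryWalk n x = 2 * sawtooth x + sawtoothSum n x - 2 * sawtooth (2 ^ n * x) := by
  induction n with
  | zero => simp [binaryWalk, sawtoothSum]
  | succ n ih =>
    rw [binaryWalk_succ, ih, sawtoothSum_succ, binaryStep, pow_succ', mul_assoc]; ring

theorem binaryWalk_add_one (n : ℕ) (x : ℝ) : binaryWalk n (x + 1) = binaryWalk n x := by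
  have := sawtooth_add_nat (2 ^ n * x) (2 ^ n)
  push_cast at this
  rw [binaryWalk_eq, binaryWalk_eq, sawtooth_add_one, sawtoothSum_add_one, ← this]; ring_nf

/-! ### The symmetric walk operator -/

/-- Averaging over one step `±1/2` of the symmetric random walk. -/
noncomputable def walkStep (g : ℝ → ℝ) (r : ℝ) : ℝ := (g (r + 1 / 2) + g (r - 1 / 2)) / 2

/-- The central difference with step `1/2`. -/
noncomputable def centralDiff (g : ℝ → ℝ) (r : ℝ) : ℝ := g (r + 1 / 2) - g (r - 1 / 2)

/-- The one-step case of the integration by parts; `1/4` is the variance of a step. -/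
theorem walkStep_id_mul (g : ℝ → ℝ) :
    walkStep (fun r => r * g r) = fun r => r * walkStep g r + 1 / 4 * centralDiff g r := by
  ext r; simp only [walkStep, centralDiff]; ring

theorem walkStep_iterate_add (n : ℕ) (g k : ℝ → ℝ) (r : ℝ) (c : ℝ) :
    walkStep^[n] (fun r => g r + c * k r) r = walkStep^[n] g r + c * walkStep^[n] k r := by
  induction n generalizing g k with
  | zero => rfl
  | succ n ih =>
    have : walkStep (fun r => g r + c * k r) = fun r => walkStep g r + c * walkStep k r := by
      ext r; simp only [walkStep]; ring
    rw [Function.iterate_succ_apply, this, ih]; rfl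

theorem walkStep_centralDiff (g : ℝ → ℝ) :
    centralDiff (walkStep g) = walkStep (centralDiff g) := by
  ext r; simp only [walkStep, centralDiff]; ring_nf

/-- Discrete integration by parts for the symmetric random walk. -/
theorem walkStep_iterate_id_mul (n : ℕ) (g : ℝ → ℝ) (r : ℝ) :
    walkStep^[n + 1] (fun r => r * g r) r =
      r * walkStep^[n + 1] g r + (n + 1) / 4 * walkStep^[n] (centralDiff g) r := by
  induction n generalizing g with
  | zero => simp [walkStep_id_mul]
  | succ n ih =>
    rw [Function.iterate_succ_apply, walkStep_id_mul, walkStep_iterate_add, ih,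
      walkStep_centralDiff]
    simp only [← Function.iterate_succ_apply]
    push_cast; ring

/-- The law of the first `n` binary digits, jointly with the remaining ones. -/
theorem integral_binaryWalk (n : ℕ) {g : ℝ → ℝ → ℝ} (hg : Measurable (Function.uncurry g))
    (hbd : ∀ R : ℝ, ∃ C : ℝ, ∀ r x, |r| ≤ R → |g r x| ≤ C) (hper : ∀ r x, g r (x + 1) = g r x)
    (r : ℝ) :
    ∫ x in (0 : ℝ)..1, g (r + binaryWalk n x) (2 ^ n * x) =
      walkStep^[n] (fun r => ∫ x in (0 : ℝ)..1, g r x) r := by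
  induction n generalizing r with
  | zero => simp [binaryWalk]
  | succ n ih =>
    have hperN : ∀ (m : ℕ) r x, g r (x + m) = g r x := by
      intro m; induction m with
      | zero => simp
      | succ m ihm => intro r x; push_cast; rw [← add_assoc, hper, ihm]
    obtain ⟨C, hC⟩ := hbd (|r| + 2 * (n + 1 : ℕ))
    -- Conditioning on the first digit: on each half the first step is constant, and doubling maps
    -- the half onto the unit interval. Periodicity absorbs the integer shift on the right half.
    rw [intervalIntegral_unit_eq_halves, Function.iterate_succ_apply', walkStep, ← ih, ← ih]
    · have e1 : ∀ u : ℝ, 0 ≤ u → u < 1 →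
          g (r + binaryWalk (n + 1) (u / 2)) (2 ^ (n + 1) * (u / 2)) =
            g (r - 1 / 2 + binaryWalk n u) (2 ^ n * u) := by
        intro u h0 h1
        rw [binaryWalk_succ', binaryStep_half h0 h1, mul_div_cancel₀ u two_ne_zero]
        congr 1 <;> ring
      have e2 : ∀ u : ℝ, 0 ≤ u → u < 1 →
          g (r + binaryWalk (n + 1) ((u + 1) / 2)) (2 ^ (n + 1) * ((u + 1) / 2)) =
            g (r + 1 / 2 + binaryWalk n u) (2 ^ n * u) := by
        intro u h0 h1
        have := hperN (2 ^ n) (r + 1 / 2 + binaryWalk n u) (2 ^ n * u)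
        push_cast at this
        rw [binaryWalk_succ', binaryStep_half_add_half h0 h1, mul_div_cancel₀ _ two_ne_zero,
          binaryWalk_add_one, ← this]
        congr 1 <;> ring
      rw [intervalIntegral_unit_congr e1, intervalIntegral_unit_congr e2]
      simp only [smul_eq_mul]; ring
    · refine intervalIntegrable_of_measurable_of_bounded (C := C) ?_ (fun x => ?_) _ _
      · exact hg.comp (f := fun x : ℝ => (r + binaryWalk (n + 1) x, 2 ^ (n + 1) * x))
          (by fun_prop)
      · exact hC _ _ ((abs_add_le _ _).trans (by gcongr; exact abs_binaryWalk_le _ _))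

/-! ### The standard normal distribution and the Stein equation -/

/-- The standard normal density. -/
noncomputable def normalDensity (x : ℝ) : ℝ := (Real.sqrt (2 * Real.pi))⁻¹ * Real.exp (-x ^ 2 / 2)

/-- The standard normal distribution function. -/
noncomputable def normalCDF (x : ℝ) : ℝ := ∫ y in Set.Iic x, normalDensity y

theorem normalDensity_eq : normalDensity = gaussianPDFReal 0 1 := by
  ext x; simp [normalDensity, gaussianPDFReal]

theorem normalDensity_pos (x : ℝ) : 0 < normalDensity x := by
  unfold normalDensity; positivity

theorem normalDensity_neg (x : ℝ) : normalDensity (-x) = normalDensity x := by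
  simp [normalDensity]

theorem normalDensity_le_one (x : ℝ) : normalDensity x ≤ 1 := by
  have h1 : 1 ≤ Real.sqrt (2 * Real.pi) := by
    rw [Real.one_le_sqrt]; linarith [Real.pi_gt_three]
  have h2 : Real.exp (-x ^ 2 / 2) ≤ 1 := Real.exp_le_one_iff.2 (by nlinarith [sq_nonneg x])
  calc normalDensity x ≤ 1 * 1 :=
        mul_le_mul (inv_le_one_of_one_le₀ h1) h2 (Real.exp_nonneg _) zero_le_one
    _ = 1 := one_mul 1

theorem normalDensity_antitone {x y : ℝ} (h : |x| ≤ |y|) : normalDensity y ≤ normalDensity x := by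
  unfold normalDensity
  have := sq_le_sq.2 h
  gcongr

theorem integrable_normalDensity : Integrable normalDensity := by
  rw [normalDensity_eq]; exact integrable_gaussianPDFReal 0 1

theorem integral_normalDensity : ∫ x, normalDensity x = 1 := by
  rw [normalDensity_eq]; exact integral_gaussianPDFReal_eq_one 0 one_ne_zero

theorem hasDerivAt_normalDensity (x : ℝ) : HasDerivAt normalDensity (-x * normalDensity x) x := by
  have : HasDerivAt (fun x : ℝ => -x ^ 2 / 2) (-x) x := by
    have := ((hasDerivAt_pow 2 x).neg).div_const 2
    exact this.congr_deriv (by push_cast; ring)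
  refine (this.exp.const_mul (Real.sqrt (2 * Real.pi))⁻¹).congr_deriv ?_
  simp only [normalDensity]; ring

theorem continuous_normalDensity : Continuous normalDensity := by
  unfold normalDensity; fun_prop

theorem tendsto_normalDensity_atTop : Tendsto normalDensity atTop (𝓝 0) := by
  have h : Tendsto (fun x : ℝ => -x ^ 2 / 2) atTop atBot := by
    have := (tendsto_pow_atTop (α := ℝ) two_ne_zero).atTop_div_const (two_pos)
    refine (tendsto_neg_atTop_atBot.comp this).congr fun x => by simp; ring
  rw [← mul_zero (Real.sqrt (2 * Real.pi))⁻¹]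
  exact (Real.tendsto_exp_atBot.comp h).const_mul _

theorem gaussianReal_real_eq (s : Set ℝ) :
    (gaussianReal 0 1).real s = ∫ x in s, normalDensity x := by
  rw [measureReal_def, gaussianReal_apply_eq_integral 0 one_ne_zero, ENNReal.toReal_ofReal,
    normalDensity_eq]
  exact integral_nonneg fun x => gaussianPDFReal_nonneg _ _ _

theorem gaussianReal_real_Iic (s : ℝ) : (gaussianReal 0 1).real (Set.Iic s) = normalCDF s :=
  gaussianReal_real_eq _

theorem one_sub_normalCDF (x : ℝ) : 1 - normalCDF x = ∫ y in Set.Ioi x, normalDensity y := by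
  rw [← integral_normalDensity, ← intervalIntegral.integral_Iic_add_Ioi (b := x)
    integrable_normalDensity.integrableOn integrable_normalDensity.integrableOn, normalCDF]
  ring

theorem normalCDF_nonneg (x : ℝ) : 0 ≤ normalCDF x :=
  integral_nonneg fun y => (normalDensity_pos y).le

theorem normalCDF_le_one (x : ℝ) : normalCDF x ≤ 1 := by
  rw [← sub_nonneg, one_sub_normalCDF]
  exact integral_nonneg fun y => (normalDensity_pos y).le

theorem normalCDF_sub (a b : ℝ) : normalCDF b - normalCDF a = ∫ x in a..b, normalDensity x :=
  intervalIntegral.integral_Iic_sub_Iic integrable_normalDensity.integrableOn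
    integrable_normalDensity.integrableOn

theorem hasDerivAt_normalCDF (x : ℝ) : HasDerivAt normalCDF (normalDensity x) x := by
  have h : normalCDF = fun x => normalCDF 0 + ∫ y in (0 : ℝ)..x, normalDensity y := by
    ext x; rw [← normalCDF_sub]; ring
  rw [h]
  exact (intervalIntegral.integral_hasDerivAt_right
    (continuous_normalDensity.intervalIntegrable _ _)
    (continuous_normalDensity.stronglyMeasurableAtFilter _ _)
    continuous_normalDensity.continuousAt).const_add _

theorem continuous_normalCDF : Continuous normalCDF :=
  continuous_iff_continuousAt.2 fun x => (hasDerivAt_normalCDF x).continuousAt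

theorem normalCDF_mono : Monotone normalCDF := by
  refine monotone_of_hasDerivAt_nonneg hasDerivAt_normalCDF fun x => (normalDensity_pos x).le

theorem normalCDF_sub_le {a b : ℝ} (h : a ≤ b) : normalCDF b - normalCDF a ≤ b - a := by
  rw [normalCDF_sub]
  calc ∫ x in a..b, normalDensity x ≤ ∫ x in a..b, (1 : ℝ) :=
        intervalIntegral.integral_mono_on h (continuous_normalDensity.intervalIntegrable _ _)
          (by simp) fun x _ => normalDensity_le_one x
    _ = b - a := by simp

theorem normalCDF_neg (x : ℝ) : normalCDF (-x) = 1 - normalCDF x := by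
  rw [one_sub_normalCDF, normalCDF, ← integral_comp_neg_Ioi]
  simp [normalDensity_neg]

/-- Mills' ratio bound. -/
theorem mul_one_sub_normalCDF_le {x : ℝ} (hx : 0 ≤ x) :
    x * (1 - normalCDF x) ≤ normalDensity x := by
  have hd : ∀ y ∈ Set.Ici x, HasDerivAt (fun y => -normalDensity y) (y * normalDensity y) y := by
    intro y _
    exact (hasDerivAt_normalDensity y).neg.congr_deriv (by ring)
  have hpos : ∀ y ∈ Set.Ioi x, 0 ≤ y * normalDensity y := fun y hy =>
    mul_nonneg (hx.trans (le_of_lt hy)) (normalDensity_pos y).le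
  have hlim : Tendsto (fun y => -normalDensity y) atTop (𝓝 0) := by
    simpa using tendsto_normalDensity_atTop.neg
  have h1 := integral_Ioi_of_hasDerivAt_of_nonneg' hd hpos hlim
  rw [one_sub_normalCDF, ← integral_const_mul]
  calc ∫ y in Set.Ioi x, x * normalDensity y ≤ ∫ y in Set.Ioi x, y * normalDensity y := by
        refine setIntegral_mono_on (integrable_normalDensity.integrableOn.const_mul x)
          (integrableOn_Ioi_deriv_of_nonneg' hd hpos hlim) measurableSet_Ioi fun y hy => ?_
        exact mul_le_mul_of_nonneg_right (le_of_lt hy) (normalDensity_pos y).le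
    _ = normalDensity x := by rw [h1]; ring

/-- The solution of the Stein equation for the half-line `(-∞, s]`. -/
noncomputable def steinSol (s x : ℝ) : ℝ :=
  normalCDF (min x s) * (1 - normalCDF (max x s)) / normalDensity x

theorem continuous_steinSol (s : ℝ) : Continuous (steinSol s) := by
  unfold steinSol
  refine Continuous.div ?_ continuous_normalDensity fun x => (normalDensity_pos x).ne'
  exact (continuous_normalCDF.comp (by fun_prop)).mul
    (continuous_const.sub (continuous_normalCDF.comp (by fun_prop)))

theorem steinSol_nonneg (s x : ℝ) : 0 ≤ steinSol s x :=
  div_nonneg (mul_nonneg (normalCDF_nonneg _) (sub_nonneg.2 (normalCDF_le_one _)))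
    (normalDensity_pos x).le

/-- Of the two factors in the numerator, each at most `1`, keep only the one that is a Gaussian tail
on the side of `x`. The bound is uniform in `s`, so Mills' ratio applies. -/
theorem steinSol_le (s x : ℝ) : steinSol s x ≤ (1 - normalCDF |x|) / normalDensity x := by
  refine div_le_div_of_nonneg_right ?_ (normalDensity_pos x).le
  have h1 := normalCDF_mono (min_le_left x s)
  have h2 := normalCDF_mono (le_max_left x s)
  have h3 := normalCDF_nonneg (min x s)
  have h4 := normalCDF_le_one (max x s)
  have h5 := normalCDF_le_one (min x s)
  have h6 := normalCDF_nonneg (max x s)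
  rcases abs_cases x with ⟨h, _⟩ | ⟨h, _⟩
  · rw [h]; nlinarith
  · rw [h, normalCDF_neg]; nlinarith

theorem abs_mul_steinSol_le (s x : ℝ) : |x| * steinSol s x ≤ 1 := by
  have h := mul_one_sub_normalCDF_le (abs_nonneg x)
  have h' : normalDensity |x| = normalDensity x := by
    unfold normalDensity; rw [sq_abs]
  rw [h'] at h
  calc |x| * steinSol s x ≤ |x| * ((1 - normalCDF |x|) / normalDensity x) :=
        mul_le_mul_of_nonneg_left (steinSol_le s x) (abs_nonneg x)
    _ = |x| * (1 - normalCDF |x|) / normalDensity x := by ring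
    _ ≤ 1 := (div_le_one (normalDensity_pos x)).2 h

theorem steinSol_le_const (s x : ℝ) : steinSol s x ≤ 1 / normalDensity 1 := by
  have h1 : 1 ≤ 1 / normalDensity 1 :=
    (one_le_div (normalDensity_pos 1)).2 (normalDensity_le_one 1)
  rcases le_total |x| 1 with hx | hx
  · have h0 := normalCDF_nonneg |x|
    calc steinSol s x ≤ (1 - normalCDF |x|) / normalDensity x := steinSol_le s x
      _ ≤ 1 / normalDensity x :=
        div_le_div_of_nonneg_right (by linarith) (normalDensity_pos x).le
      _ ≤ 1 / normalDensity 1 :=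
        one_div_le_one_div_of_le (normalDensity_pos 1) (normalDensity_antitone (by simpa using hx))
  · refine le_trans ?_ h1
    have := abs_mul_steinSol_le s x
    nlinarith [steinSol_nonneg s x]

/-- The derivative of `steinSol s` off `s`, as given by the Stein equation. -/
noncomputable def steinDeriv (s x : ℝ) : ℝ :=
  x * steinSol s x + (Set.Iic s).indicator 1 x - normalCDF s

theorem hasDerivAt_steinSol {s x : ℝ} (hx : x ≠ s) :
    HasDerivAt (steinSol s) (steinDeriv s x) x := by
  have hp := (normalDensity_pos x).ne'
  rcases lt_or_gt_of_ne hx with h | h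
  · have hev : (fun y => normalCDF y * (1 - normalCDF s) / normalDensity y) =ᶠ[𝓝 x] steinSol s := by
      filter_upwards [Iio_mem_nhds h] with y hy
      rw [steinSol, min_eq_left (le_of_lt hy), max_eq_right (le_of_lt hy)]
    refine (((((hasDerivAt_normalCDF x).mul_const _).div (hasDerivAt_normalDensity x) hp)).congr_of_eventuallyEq
      hev.symm).congr_deriv ?_
    rw [steinDeriv, ← hev.eq_of_nhds, Set.indicator_of_mem (show x ∈ Set.Iic s from h.le)]
    simp only [Pi.one_apply]
    field_simp; ring
  · have hev : (fun y => normalCDF s * (1 - normalCDF y) / normalDensity y) =ᶠ[𝓝 x] steinSol s := by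
      filter_upwards [Ioi_mem_nhds h] with y hy
      rw [steinSol, min_eq_right (le_of_lt hy), max_eq_left (le_of_lt hy)]
    refine ((((((hasDerivAt_normalCDF x).const_sub 1).const_mul _).div
      (hasDerivAt_normalDensity x) hp)).congr_of_eventuallyEq hev.symm).congr_deriv ?_
    rw [steinDeriv, ← hev.eq_of_nhds, Set.indicator_of_notMem (show x ∉ Set.Iic s from not_le.2 h)]
    field_simp; ring

theorem abs_steinDeriv_le (s x : ℝ) : |steinDeriv s x| ≤ 2 := by
  have h1 : |x * steinSol s x| ≤ 1 := by
    rw [abs_mul, abs_of_nonneg (steinSol_nonneg s x)]; exact abs_mul_steinSol_le s x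
  have h2 := normalCDF_nonneg s
  have h3 := normalCDF_le_one s
  rw [abs_le] at h1 ⊢
  by_cases hx : x ∈ Set.Iic s <;> simp only [steinDeriv, hx, Set.indicator_of_mem,
    Set.indicator_of_notMem, not_false_eq_true, Pi.one_apply] <;> constructor <;> linarith

@[fun_prop]
theorem measurable_steinDeriv (s : ℝ) : Measurable (steinDeriv s) := by
  have := (continuous_steinSol s).measurable
  have h : Measurable ((Set.Iic s).indicator (1 : ℝ → ℝ)) :=
    measurable_one.indicator measurableSet_Iic
  exact ((measurable_id.mul this).add h).sub_const _

/-- The kink at `s` is a single point and the derivative is bounded, so the fundamental theorem of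
calculus survives. The zero bias identity uses differentiability only in this integrated form. -/
theorem integral_steinDeriv (s a b : ℝ) :
    ∫ x in a..b, steinDeriv s x = steinSol s b - steinSol s a :=
  integral_eq_of_hasDerivAt_off_countable _ _ (Set.countable_singleton s)
    (continuous_steinSol s).continuousOn (fun _ hx => hasDerivAt_steinSol hx.2)
    (intervalIntegrable_of_measurable_of_bounded (measurable_steinDeriv s)
      (fun x => abs_steinDeriv_le s x) a b)

theorem abs_steinSol_sub_le (s a b : ℝ) : |steinSol s b - steinSol s a| ≤ 2 * |b - a| := by
  rw [← integral_steinDeriv]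
  exact intervalIntegral.norm_integral_le_of_norm_le_const
    fun x _ => (Real.norm_eq_abs _).trans_le (abs_steinDeriv_le s x)

theorem abs_mul_steinSol_sub_le (s a b : ℝ) :
    |a * steinSol s a - b * steinSol s b| ≤ (2 * |a| + 1 / normalDensity 1) * |a - b| := by
  have h : a * steinSol s a - b * steinSol s b =
      a * (steinSol s a - steinSol s b) + (a - b) * steinSol s b := by ring
  have h2 : |steinSol s b| ≤ 1 / normalDensity 1 := by
    rw [abs_of_nonneg (steinSol_nonneg s b)]; exact steinSol_le_const s b
  calc _ ≤ |a| * |steinSol s a - steinSol s b| + |a - b| * |steinSol s b| := by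
        rw [h, ← abs_mul, ← abs_mul]; exact abs_add_le _ _
    _ ≤ |a| * (2 * |a - b|) + |a - b| * (1 / normalDensity 1) := by
        gcongr; exact abs_steinSol_sub_le s b a
    _ = _ := by ring

/-! ### Zero bias coupling and Kolmogorov distance -/

/-- The zero bias partner of the walk `binaryWalk (m + 1)`: its last step is replaced by a uniform
random variable on `[-1/2, 1/2]`. -/
noncomputable def zeroBiasWalk (m : ℕ) (x : ℝ) : ℝ := binaryWalk m x + sawtooth (2 ^ m * x)

@[fun_prop]
theorem measurable_zeroBiasWalk (m : ℕ) : Measurable (zeroBiasWalk m) := by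
  unfold zeroBiasWalk; fun_prop

/-- With `u = 2^m x` the difference is `f(u) - f(2u)`. -/
theorem abs_binaryWalk_sub_zeroBiasWalk_le (m : ℕ) (x : ℝ) :
    |binaryWalk (m + 1) x - zeroBiasWalk m x| ≤ 1 := by
  have h1 := abs_le.1 (abs_sawtooth_le (2 ^ m * x))
  have h2 := abs_le.1 (abs_sawtooth_le (2 * (2 ^ m * x)))
  rw [binaryWalk_succ, zeroBiasWalk, binaryStep, abs_le]
  constructor <;> linarith

/-- By `binaryWalk_eq` the difference is `f(2^(m+1) x) + f(2^m x) - 2 f(x)`. -/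
theorem abs_sawtoothSum_sub_zeroBiasWalk_le (m : ℕ) (x : ℝ) :
    |sawtoothSum (m + 1) x - zeroBiasWalk m x| ≤ 2 := by
  have h1 := abs_le.1 (abs_sawtooth_le (2 ^ m * x))
  have h2 := abs_le.1 (abs_sawtooth_le (2 ^ (m + 1) * x))
  have h3 := abs_le.1 (abs_sawtooth_le x)
  rw [sawtoothSum_succ, zeroBiasWalk, binaryWalk_eq, abs_le]
  constructor <;> linarith

theorem integral_binaryWalk_mul (m : ℕ) {F : ℝ → ℝ} (hF : Measurable F)
    (hbd : ∀ R : ℝ, ∃ C : ℝ, ∀ r, |r| ≤ R → |F r| ≤ C) :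
    ∫ x in (0 : ℝ)..1, binaryWalk (m + 1) x * F (binaryWalk (m + 1) x) =
      (m + 1) / 4 * walkStep^[m] (centralDiff F) 0 := by
  have h := integral_binaryWalk (m + 1) (g := fun r _ => r * F r) (by fun_prop) (fun R => by
    obtain ⟨C, hC⟩ := hbd R
    refine ⟨R * C, fun r _ hr => ?_⟩
    rw [abs_mul]
    exact mul_le_mul hr (hC r hr) (abs_nonneg _) ((abs_nonneg _).trans hr)) (fun _ _ => rfl) 0
  simp only [zero_add] at h
  rw [h]
  simp [walkStep_iterate_id_mul]

theorem walkStep_iterate_const (m : ℕ) (c r : ℝ) : walkStep^[m] (fun _ => c) r = c := by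
  induction m with
  | zero => rfl
  | succ m ih =>
    have : walkStep (fun _ => c) = fun _ => c := by ext; simp [walkStep]
    rw [Function.iterate_succ_apply, this, ih]

theorem integral_binaryWalk_sq (m : ℕ) :
    ∫ x in (0 : ℝ)..1, binaryWalk (m + 1) x ^ 2 = (m + 1) / 4 := by
  have h := integral_binaryWalk_mul m (F := fun r => r) measurable_id fun R => ⟨R, fun r hr => hr⟩
  have hc : centralDiff (fun r => r) = fun _ => 1 := by ext; simp [centralDiff]; norm_num
  rw [hc, walkStep_iterate_const, mul_one] at h
  simp_rw [sq, h]

/-- The added term `f(2^m x)` is uniform on `[-1/2, 1/2]` and independent of the first `m` digits;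
averaging `F'` over it produces the central difference of `F`, as in `integral_binaryWalk_mul`. -/
theorem integral_zeroBiasWalk (m : ℕ) {F F' : ℝ → ℝ} (hF' : Measurable F') {C : ℝ}
    (hC : ∀ x, |F' x| ≤ C) (hFTC : ∀ a b, ∫ x in a..b, F' x = F b - F a) :
    ∫ x in (0 : ℝ)..1, F' (zeroBiasWalk m x) = walkStep^[m] (centralDiff F) 0 := by
  have h := integral_binaryWalk m (g := fun r x => F' (r + sawtooth x)) (by
      simp only [Function.uncurry_def]; fun_prop)
    (fun R => ⟨C, fun r _ _ => hC _⟩) (fun r x => by rw [sawtooth_add_one]) 0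
  simp only [zero_add] at h
  simp only [zeroBiasWalk]
  rw [h]
  refine congrArg (fun g => walkStep^[m] g 0) (funext fun r => ?_)
  rw [intervalIntegral_unit_congr (l := fun x => F' (r - 1 / 2 + x)) fun x h0 h1 => by
    rw [sawtooth_of_mem_Ico h0 h1]; ring_nf]
  rw [intervalIntegral.integral_comp_add_left F', hFTC, centralDiff]
  ring_nf

/-- The zero bias identity. -/
theorem integral_binaryWalk_mul_eq_zeroBias (m : ℕ) {F F' : ℝ → ℝ} (hF : Continuous F)
    (hF' : Measurable F') {C : ℝ} (hC : ∀ x, |F' x| ≤ C)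
    (hFTC : ∀ a b, ∫ x in a..b, F' x = F b - F a) :
    ∫ x in (0 : ℝ)..1, binaryWalk (m + 1) x * F (binaryWalk (m + 1) x) =
      (m + 1) / 4 * ∫ x in (0 : ℝ)..1, F' (zeroBiasWalk m x) := by
  rw [integral_zeroBiasWalk m hF' hC hFTC, integral_binaryWalk_mul m hF.measurable]
  intro R
  obtain ⟨C, hC⟩ := (isCompact_closedBall (0 : ℝ) R).exists_bound_of_continuousOn hF.continuousOn
  exact ⟨C, fun r hr => hC r (by simpa using hr)⟩

theorem integral_indicator_le (Y : ℝ → ℝ) (hY : Measurable Y) (s : ℝ) :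
    ∫ x in (0 : ℝ)..1, (Set.Iic s).indicator (1 : ℝ → ℝ) (Y x) =
      unitMeasure.real {x | Y x ≤ s} := by
  rw [← integral_unitMeasure]
  have : (fun x => (Set.Iic s).indicator (1 : ℝ → ℝ) (Y x)) = {x | Y x ≤ s}.indicator 1 := by
    ext x; simp [Set.indicator_apply]
  rw [this, integral_indicator_one (measurableSet_le hY measurable_const)]

/-- Normal approximation of the zero bias walk in Kolmogorov distance. -/
theorem abs_zeroBiasWalk_cdf_sub_le (m : ℕ) {h : ℝ} (hpos : 0 < h) (hh : h ^ 2 * (m + 1) = 4)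
    (s : ℝ) :
    |unitMeasure.real {x | h * zeroBiasWalk m x ≤ s} - normalCDF s| ≤
      (2 + 1 / normalDensity 1) * h := by
  set F := steinSol s with hF
  set w : ℝ → ℝ := fun x => h * binaryWalk (m + 1) x with hw
  set v : ℝ → ℝ := fun x => h * zeroBiasWalk m x with hv
  have hwm : Measurable w := by fun_prop
  have hvm : Measurable v := by fun_prop
  have hFm : Measurable F := (continuous_steinSol s).measurable
  have hxF : ∀ x, ‖x * F x‖ ≤ 1 := fun x => by
    rw [norm_mul, Real.norm_eq_abs, Real.norm_eq_abs, abs_of_nonneg (steinSol_nonneg s x)]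
    exact abs_mul_steinSol_le s x
  have hbias : ∫ x in (0 : ℝ)..1, w x * F (w x) = ∫ x in (0 : ℝ)..1, steinDeriv s (v x) := by
    have := integral_binaryWalk_mul_eq_zeroBias m (F := fun r => h⁻¹ * F (h * r))
      (F' := fun r => steinDeriv s (h * r)) (by
        exact continuous_const.mul ((continuous_steinSol s).comp (by fun_prop))) (by fun_prop)
      (fun x => abs_steinDeriv_le s _) (fun a b => by
        rw [intervalIntegral.integral_comp_mul_left _ hpos.ne', integral_steinDeriv, smul_eq_mul,
          mul_sub])
    have e : ∀ x, w x * F (w x) = h ^ 2 *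
        (binaryWalk (m + 1) x * (h⁻¹ * F (h * binaryWalk (m + 1) x))) := fun x => by
      simp only [hw]; field_simp
    simp_rw [e]
    rw [intervalIntegral.integral_const_mul, this, ← mul_assoc, ← mul_div_assoc, hh]
    simp [hv]
  have i1 : IntervalIntegrable (fun x => w x * F (w x)) volume 0 1 :=
    intervalIntegrable_of_measurable_of_bounded (by fun_prop) (fun x => hxF _) _ _
  have i2 : IntervalIntegrable (fun x => v x * F (v x)) volume 0 1 :=
    intervalIntegrable_of_measurable_of_bounded (by fun_prop) (fun x => hxF _) _ _
  have i3 : IntervalIntegrable (fun x => steinDeriv s (v x)) volume 0 1 :=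
    intervalIntegrable_of_measurable_of_bounded (by fun_prop)
      (fun x => (Real.norm_eq_abs _).trans_le (abs_steinDeriv_le s _)) _ _
  have i4 : IntervalIntegrable (fun x => w x ^ 2) volume 0 1 := by
    refine intervalIntegrable_of_measurable_of_bounded (C := (h * (2 * (m + 1 : ℕ))) ^ 2)
      (by fun_prop) (fun x => ?_) _ _
    rw [norm_pow, Real.norm_eq_abs, hw, abs_mul, abs_of_pos hpos]
    gcongr; exact abs_binaryWalk_le _ x
  -- The Stein equation at `v`, with the integral of `F'(v)` replaced by that of `w F(w)`. What
  -- remains is a difference of the locally Lipschitz function `x F(x)` at two close points.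
  have key : unitMeasure.real {x | v x ≤ s} - normalCDF s =
      ∫ x in (0 : ℝ)..1, (w x * F (w x) - v x * F (v x)) := by
    rw [intervalIntegral.integral_sub i1 i2, hbias, ← intervalIntegral.integral_sub i3 i2]
    have e : ∀ x, steinDeriv s (v x) - v x * F (v x) =
        (Set.Iic s).indicator (1 : ℝ → ℝ) (v x) - normalCDF s := fun x => by
      rw [steinDeriv]; ring
    simp_rw [e]
    rw [intervalIntegral.integral_sub _ (by simp), integral_indicator_le v hvm]
    · simp
    · refine intervalIntegrable_of_measurable_of_bounded (C := 1)
        ((measurable_one.indicator measurableSet_Iic).comp hvm) (fun x => ?_) _ _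
      by_cases hx : v x ∈ Set.Iic s <;> simp [hx, Set.indicator]
  rw [key]
  have hdiff : ∀ x, |w x - v x| ≤ h := fun x => by
    rw [hw, hv, ← mul_sub, abs_mul, abs_of_pos hpos]
    exact mul_le_of_le_one_right hpos.le (abs_binaryWalk_sub_zeroBiasWalk_le m x)
  have hc : 0 < normalDensity 1 := normalDensity_pos 1
  have hpt : ∀ x, ‖w x * F (w x) - v x * F (v x)‖ ≤
      h * w x ^ 2 + (1 + 1 / normalDensity 1) * h := fun x => by
    refine (abs_mul_steinSol_sub_le s (w x) (v x)).trans ?_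
    -- Trades the first absolute moment for the second moment, which is exactly `1` by the
    -- normalisation `h ^ 2 * (m + 1) = 4`.
    have h2 : 2 * |w x| ≤ w x ^ 2 + 1 := by nlinarith [sq_nonneg (|w x| - 1), sq_abs (w x)]
    calc _ ≤ (w x ^ 2 + 1 + 1 / normalDensity 1) * h := by
          gcongr; exact hdiff x
      _ = _ := by ring
  have hw2 : ∫ x in (0 : ℝ)..1, w x ^ 2 = 1 := by
    simp_rw [hw, mul_pow]
    rw [intervalIntegral.integral_const_mul, integral_binaryWalk_sq, ← mul_div_assoc, hh]
    norm_num
  have := intervalIntegral.norm_integral_le_of_norm_le zero_le_one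
    (ae_of_all _ fun x _ => hpt x) ((i4.const_mul h).add (by simp))
  rw [intervalIntegral.integral_add (i4.const_mul h) (by simp),
    intervalIntegral.integral_const_mul, hw2] at this
  refine this.trans (le_of_eq ?_)
  simp; ring

/-- Normal approximation of `2 S_n / √n` with the rate `n ^ (-1/2)`. -/
theorem exists_abs_sawtoothSum_cdf_sub_le : ∃ K : ℝ, 0 < K ∧ ∀ n : ℕ, 1 ≤ n → ∀ s : ℝ,
    |unitMeasure.real {x | 2 * sawtoothSum n x / Real.sqrt n ≤ s} - normalCDF s| ≤
      K * (4 / Real.sqrt n) := by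
  have hc : 0 < normalDensity 1 := normalDensity_pos 1
  -- With `h = 2/√n`, the zero bias bound costs `(2 + 1 / normalDensity 1) * h`, and shifting the
  -- threshold by `2 * h` costs another `2 * h`.
  refine ⟨4 + 1 / normalDensity 1, by positivity, fun n hn s => ?_⟩
  obtain ⟨m, rfl⟩ : ∃ m, n = m + 1 := ⟨n - 1, by omega⟩
  have hs : 0 < Real.sqrt (m + 1 : ℕ) := by positivity
  set h : ℝ := 2 / Real.sqrt (m + 1 : ℕ) with hh
  have hpos : 0 < h := by positivity
  have hh2 : h ^ 2 * (m + 1) = 4 := by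
    rw [hh, div_pow, Real.sq_sqrt (by positivity)]; push_cast; field_simp; norm_num
  have hY : ∀ x, |2 * sawtoothSum (m + 1) x / Real.sqrt (m + 1 : ℕ) - h * zeroBiasWalk m x| ≤
      2 * h := fun x => by
    have : 2 * sawtoothSum (m + 1) x / Real.sqrt (m + 1 : ℕ) - h * zeroBiasWalk m x =
        h * (sawtoothSum (m + 1) x - zeroBiasWalk m x) := by rw [hh]; ring
    rw [this, abs_mul, abs_of_pos hpos, mul_comm]
    gcongr; exact abs_sawtoothSum_sub_zeroBiasWalk_le m x
  have hup := (abs_le.1 (abs_zeroBiasWalk_cdf_sub_le m hpos hh2 (s + 2 * h))).2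
  have hlo := (abs_le.1 (abs_zeroBiasWalk_cdf_sub_le m hpos hh2 (s - 2 * h))).1
  have m1 : unitMeasure.real {x | 2 * sawtoothSum (m + 1) x / Real.sqrt (m + 1 : ℕ) ≤ s} ≤
      unitMeasure.real {x | h * zeroBiasWalk m x ≤ s + 2 * h} := by
    refine measureReal_mono fun x hx => ?_
    have := abs_le.1 (hY x)
    simp only [Set.mem_ofPred_eq] at hx ⊢
    linarith
  have m2 : unitMeasure.real {x | h * zeroBiasWalk m x ≤ s - 2 * h} ≤
      unitMeasure.real {x | 2 * sawtoothSum (m + 1) x / Real.sqrt (m + 1 : ℕ) ≤ s} := by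
    refine measureReal_mono fun x hx => ?_
    have := abs_le.1 (hY x)
    simp only [Set.mem_ofPred_eq] at hx ⊢
    linarith
  have g1 := normalCDF_sub_le (show s ≤ s + 2 * h by linarith)
  have g2 := normalCDF_sub_le (show s - 2 * h ≤ s by linarith)
  have e : (4 + 1 / normalDensity 1) * (4 / Real.sqrt (m + 1 : ℕ)) =
      2 * ((4 + 1 / normalDensity 1) * h) := by rw [hh]; ring
  have hn : 0 ≤ (4 + 1 / normalDensity 1) * h := by positivity
  rw [e, abs_le]
  constructor <;> linarith

theorem exists_kolmogorovDist_sawtoothSum_le : ∃ C : ℝ, 0 < C ∧ ∀ n : ℕ, 1 ≤ n →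
    kolmogorovDist (unitMeasure.map (fun x : ℝ => 2 * sawtoothSum n x / Real.sqrt (n : ℝ)))
      (gaussianReal 0 1) ≤ C * (4 / Real.sqrt (n : ℝ)) ^ (13 / 24 : ℝ) := by
  obtain ⟨K, hK, h⟩ := exists_abs_sawtoothSum_cdf_sub_le
  -- The factor `4` bounds the surplus power `u ^ (11/24)`, where `u = 4/√n ≤ 4`.
  refine ⟨K * 4, by positivity, fun n hn => ciSup_le fun s => ?_⟩
  rw [gaussianReal_real_Iic, map_measureReal_apply (by fun_prop) measurableSet_Iic]
  refine (h n hn s).trans ?_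
  have hs : 1 ≤ Real.sqrt n := Real.one_le_sqrt.2 (by exact_mod_cast hn)
  set u := 4 / Real.sqrt n with hu
  have hu0 : 0 < u := by positivity
  have hu4 : u ≤ 4 := div_le_self (by norm_num) hs
  have : u = u ^ (11 / 24 : ℝ) * u ^ (13 / 24 : ℝ) := by
    rw [← Real.rpow_add hu0]; norm_num
  have h4 : u ^ (11 / 24 : ℝ) ≤ 4 := calc
    u ^ (11 / 24 : ℝ) ≤ 4 ^ (11 / 24 : ℝ) := Real.rpow_le_rpow hu0.le hu4 (by norm_num)
    _ ≤ 4 ^ (1 : ℝ) := Real.rpow_le_rpow_of_exponent_le (by norm_num) (by norm_num)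
    _ = 4 := Real.rpow_one 4
  rw [mul_assoc]
  gcongr
  calc u = u ^ (11 / 24 : ℝ) * u ^ (13 / 24 : ℝ) := this
    _ ≤ 4 * u ^ (13 / 24 : ℝ) := by gcongr

/-! ### The characteristic function -/

/-- The characteristic function of `a f + S_n` at `l`. -/
noncomputable def sawtoothCharFun (n : ℕ) (a l : ℝ) : ℂ :=
  ∫ x in (0 : ℝ)..1, Complex.exp (Complex.I * ((l * (a * sawtooth x + sawtoothSum n x) : ℝ) : ℂ))

theorem norm_exp_I_mul_ofReal (t : ℝ) : ‖Complex.exp (Complex.I * (t : ℂ))‖ = 1 := by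
  rw [mul_comm]; exact Complex.norm_exp_ofReal_mul_I t

/-- On the two halves `a f` becomes `(a/2) f ∓ a/4`, while the first term of `S_(n+1)` becomes a
full `f`. The phases `∓ l a / 4` average to a cosine. -/
theorem sawtoothCharFun_succ (n : ℕ) (a l : ℝ) :
    sawtoothCharFun (n + 1) a l =
      (Real.cos (l * a / 4) : ℂ) * sawtoothCharFun n (a / 2 + 1) l := by
  rw [sawtoothCharFun, intervalIntegral_unit_eq_halves, sawtoothCharFun]
  · have e1 : ∀ u : ℝ, 0 ≤ u → u < 1 → Complex.exp (Complex.I *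
        ((l * (a * sawtooth (u / 2) + sawtoothSum (n + 1) (u / 2)) : ℝ) : ℂ)) =
        Complex.exp (-(Complex.I * (l * a / 4 : ℝ))) *
          Complex.exp (Complex.I * ((l * ((a / 2 + 1) * sawtooth u + sawtoothSum n u) : ℝ) : ℂ)) := by
      intro u h0 h1
      rw [sawtooth_half h0 h1, sawtoothSum_succ', mul_div_cancel₀ u two_ne_zero, ← Complex.exp_add]
      congr 1; push_cast; ring
    have e2 : ∀ u : ℝ, 0 ≤ u → u < 1 → Complex.exp (Complex.I *
        ((l * (a * sawtooth ((u + 1) / 2) + sawtoothSum (n + 1) ((u + 1) / 2)) : ℝ) : ℂ)) =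
        Complex.exp (Complex.I * (l * a / 4 : ℝ)) *
          Complex.exp (Complex.I * ((l * ((a / 2 + 1) * sawtooth u + sawtoothSum n u) : ℝ) : ℂ)) := by
      intro u h0 h1
      rw [sawtooth_half_add_half h0 h1, sawtoothSum_succ', sawtooth_two_mul_add_one,
        mul_div_cancel₀ _ two_ne_zero, sawtoothSum_add_one, ← Complex.exp_add]
      congr 1; push_cast; ring
    rw [intervalIntegral_unit_congr e1, intervalIntegral_unit_congr e2,
      intervalIntegral.integral_const_mul, intervalIntegral.integral_const_mul,
      Complex.ofReal_cos, Complex.cos, Complex.real_smul, Complex.real_smul]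
    rw [mul_comm Complex.I, neg_mul]
    push_cast; ring
  · exact intervalIntegrable_of_measurable_of_bounded (C := 1) (by fun_prop)
      (fun x => (norm_exp_I_mul_ofReal _).le) _ _

/-- The numbers `2 - 2 * (1/2)^j` are the orbit of `0` under `a ↦ a/2 + 1`, whose fixed point is
`2`. The free `j` serves the induction; `j = 0` is the case of `S_n` itself. -/
theorem sawtoothCharFun_eq_prod (n j : ℕ) (l : ℝ) :
    sawtoothCharFun n (2 - 2 * (1 / 2) ^ j) l =
      (∏ i ∈ Finset.range n, (Real.cos (l * (2 - 2 * (1 / 2) ^ (j + i)) / 4) : ℂ)) *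
        sawtoothCharFun 0 (2 - 2 * (1 / 2) ^ (j + n)) l := by
  induction n generalizing j with
  | zero => simp
  | succ n ih =>
    have : ((2 - 2 * (1 / 2) ^ j) / 2 + 1 : ℝ) = 2 - 2 * (1 / 2) ^ (j + 1) := by
      rw [pow_succ]; ring
    rw [sawtoothCharFun_succ, this, ih, Finset.prod_range_succ', ← mul_assoc]
    simp only [add_zero, add_assoc, add_comm 1]
    congr 1
    rw [mul_comm]

theorem integral_sawtooth : ∫ x in (0 : ℝ)..1, sawtooth x = 0 := by
  rw [intervalIntegral_unit_congr (fun x h0 h1 => sawtooth_of_mem_Ico h0 h1),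
    intervalIntegral.integral_sub (by simp) (by simp)]
  simp

/-- Since `f` has mean zero, the linear term of the exponential integrates to zero. -/
theorem norm_sawtoothCharFun_zero_sub_one_le {a l : ℝ} (ha : |a| ≤ 2) (hl : |l| ≤ 1) :
    ‖sawtoothCharFun 0 a l - 1‖ ≤ l ^ 2 := by
  have hb : ∀ x, |l * (a * sawtooth x)| ≤ |l| := fun x => by
    have h1 := abs_sawtooth_le x
    rw [abs_mul, abs_mul]
    have : |a| * |sawtooth x| ≤ 2 * (1 / 2) := by gcongr
    nlinarith [abs_nonneg l]
  have hi : IntervalIntegrable (fun x => Complex.I * ((l * (a * sawtooth x) : ℝ) : ℂ)) volume 0 1 :=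
    intervalIntegrable_of_measurable_of_bounded (C := |l|) (by fun_prop)
      (fun x => by simpa using hb x) _ _
  have he : IntervalIntegrable (fun x => Complex.exp (Complex.I * ((l * (a * sawtooth x) : ℝ) : ℂ)))
      volume 0 1 :=
    intervalIntegrable_of_measurable_of_bounded (C := 1) (by fun_prop)
      (fun x => (norm_exp_I_mul_ofReal _).le) _ _
  have h0 : ∫ x in (0 : ℝ)..1, Complex.I * ((l * (a * sawtooth x) : ℝ) : ℂ) = 0 := by
    rw [intervalIntegral.integral_const_mul, intervalIntegral.integral_ofReal,
      intervalIntegral.integral_const_mul, intervalIntegral.integral_const_mul, integral_sawtooth]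
    simp
  have key : sawtoothCharFun 0 a l - 1 = ∫ x in (0 : ℝ)..1,
      (Complex.exp (Complex.I * ((l * (a * sawtooth x) : ℝ) : ℂ)) - 1 -
        Complex.I * ((l * (a * sawtooth x) : ℝ) : ℂ)) := by
    rw [intervalIntegral.integral_sub (he.sub (by simp)) hi, h0,
      intervalIntegral.integral_sub he (by simp)]
    simp [sawtoothCharFun, sawtoothSum_zero]
  rw [key]
  refine (intervalIntegral.norm_integral_le_of_norm_le_const (C := l ^ 2) fun x _ => ?_).trans
    (by simp)
  have hn : ‖Complex.I * ((l * (a * sawtooth x) : ℝ) : ℂ)‖ = |l * (a * sawtooth x)| := by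
    rw [norm_mul, Complex.norm_I, one_mul, Complex.norm_real, Real.norm_eq_abs]
  refine (Complex.norm_exp_sub_one_sub_id_le (hn.trans_le ((hb x).trans hl))).trans ?_
  rw [hn, sq_abs]
  exact sq_le_sq.2 (hb x)

/-- At `q = 0` the quadratic terms cancel and only a quartic error is left. The mismatch for `q > 0`
is controlled linearly in `q`, so it sums geometrically for `q = (1/2)^i`. -/
theorem abs_cos_mul_exp_sub_one_le {l q : ℝ} (hl : |l| ≤ 1) (hq : 0 ≤ q) (hq1 : q ≤ 1) :
    |Real.cos (l * (2 - 2 * q) / 4) * Real.exp (l ^ 2 / 8) - 1| ≤ l ^ 4 + l ^ 2 * q / 2 := by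
  set t := l * (2 - 2 * q) / 4 with ht
  set b := l ^ 2 / 8 with hb
  have hl2 : l ^ 2 ≤ 1 := (sq_le_one_iff_abs_le_one l).2 hl
  have hb0 : 0 ≤ b := by positivity
  have hb1 : b ≤ 1 / 8 := by linarith
  have ht2 : t ^ 2 = l ^ 2 * (1 - q) ^ 2 / 4 := by rw [ht]; ring
  have ht2' : t ^ 2 ≤ l ^ 2 / 4 := by
    rw [ht2]
    have : (1 - q) ^ 2 ≤ 1 := by nlinarith
    nlinarith [sq_nonneg l]
  have ht1 : |t| ≤ 1 := (sq_le_one_iff_abs_le_one t).1 (by linarith)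
  have hcos := Real.cos_bound ht1
  have hexp := Real.abs_exp_sub_one_sub_id_le (x := b) (by rw [abs_of_nonneg hb0]; linarith)
  have ht4 : |t| ^ 4 ≤ l ^ 4 / 16 := by
    have : |t| ^ 4 = (t ^ 2) ^ 2 := by rw [← sq_abs t]; ring
    rw [this]
    calc (t ^ 2) ^ 2 ≤ (l ^ 2 / 4) ^ 2 := by gcongr
      _ = l ^ 4 / 16 := by ring
  have e : Real.cos t * Real.exp b - 1 = Real.cos t * (Real.exp b - 1 - b) +
      (Real.cos t - (1 - t ^ 2 / 2)) * (1 + b) + (b - t ^ 2 / 2) + -(b * t ^ 2 / 2) := by ring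
  have a1 : |Real.cos t * (Real.exp b - 1 - b)| ≤ 1 * b ^ 2 := by
    rw [abs_mul]; gcongr; exact Real.abs_cos_le_one t
  have a2 : |(Real.cos t - (1 - t ^ 2 / 2)) * (1 + b)| ≤ l ^ 4 / 16 * (5 / 96) * 2 := by
    rw [abs_mul, abs_of_nonneg (show 0 ≤ 1 + b by linarith)]
    refine mul_le_mul (hcos.trans ?_) (by linarith) (by linarith) (by positivity)
    gcongr
  have a3 : |b - t ^ 2 / 2| ≤ l ^ 2 * q / 2 := by
    have : b - t ^ 2 / 2 = l ^ 2 * (q * (2 - q)) / 8 := by rw [ht2, hb]; ring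
    rw [this, abs_of_nonneg (by have : 0 ≤ 2 - q := by linarith
                                positivity)]
    have : q * (2 - q) ≤ q * 2 := by gcongr; linarith
    nlinarith [sq_nonneg l]
  have a4 : |-(b * t ^ 2 / 2)| ≤ l ^ 4 / 64 := by
    rw [abs_neg, abs_of_nonneg (by positivity)]
    calc b * t ^ 2 / 2 ≤ b * (l ^ 2 / 4) / 2 := by gcongr
      _ = l ^ 4 / 64 := by rw [hb]; ring
  have hb2 : b ^ 2 = l ^ 4 / 64 := by rw [hb]; ring
  have hl4 : 0 ≤ l ^ 4 := by positivity
  rw [e]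
  refine (abs_add_le _ _).trans ?_
  refine (add_le_add_left ((abs_add_le _ _).trans (add_le_add_left (abs_add_le _ _) _)) _).trans ?_
  linarith

/-- Errors of the form `exp A - 1` are stable under multiplication by a further factor near `1`: the
exponents add. -/
theorem norm_mul_one_add_sub_one_le {P y : ℂ} {A B : ℝ} (hP : ‖P - 1‖ ≤ Real.exp A - 1)
    (hy : ‖y - 1‖ ≤ B) : ‖P * y - 1‖ ≤ Real.exp (A + B) - 1 := by
  have hPn : ‖P‖ ≤ Real.exp A := by
    have := norm_add_le (P - 1) 1
    rw [sub_add_cancel, norm_one] at this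
    linarith
  have e : P * y - 1 = P * (y - 1) + (P - 1) := by ring
  have h1 : ‖P * (y - 1)‖ ≤ Real.exp A * B := by
    rw [norm_mul]; gcongr
  have h2 : Real.exp A * (B + 1) ≤ Real.exp (A + B) := by
    rw [Real.exp_add]; gcongr; exact Real.add_one_le_exp B
  rw [e]
  refine (norm_add_le _ _).trans ?_
  linarith

theorem norm_sawtoothCharFun_mul_exp_sub_one_le (n : ℕ) {l : ℝ} (hl : |l| ≤ 1) :
    ‖sawtoothCharFun n 0 l * ((Real.exp (n * (l ^ 2 / 8)) : ℝ) : ℂ) - 1‖ ≤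
      Real.exp (n * l ^ 4 + 2 * l ^ 2) - 1 := by
  have hq : ∀ i : ℕ, (0 : ℝ) ≤ (1 / 2) ^ i ∧ ((1 / 2) ^ i : ℝ) ≤ 1 := fun i =>
    ⟨by positivity, pow_le_one₀ (by norm_num) (by norm_num)⟩
  set z : ℕ → ℂ := fun i =>
    ((Real.cos (l * (2 - 2 * (1 / 2) ^ i) / 4) * Real.exp (l ^ 2 / 8) - 1 : ℝ) : ℂ) with hz
  have hprod : sawtoothCharFun n 0 l * ((Real.exp (n * (l ^ 2 / 8)) : ℝ) : ℂ) =
      (∏ i ∈ Finset.range n, (1 + z i)) * sawtoothCharFun 0 (2 - 2 * (1 / 2) ^ n) l := by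
    have h := sawtoothCharFun_eq_prod n 0 l
    simp only [pow_zero, mul_one, sub_self, zero_add] at h
    have hz1 : ∀ i, 1 + z i =
        (Real.cos (l * (2 - 2 * (1 / 2) ^ i) / 4) : ℂ) * ((Real.exp (l ^ 2 / 8) : ℝ) : ℂ) := by
      intro i; simp only [hz]; push_cast; ring
    simp_rw [hz1]
    rw [h, Finset.prod_mul_distrib, Finset.prod_const, Finset.card_range, Real.exp_nat_mul]
    push_cast; ring
  have hsum : ∑ i ∈ Finset.range n, ‖z i‖ ≤ n * l ^ 4 + l ^ 2 := by
    have h1 : ∀ i ∈ Finset.range n, ‖z i‖ ≤ l ^ 4 + l ^ 2 / 2 * (1 / 2) ^ i := fun i _ => by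
      rw [hz, Complex.norm_real, Real.norm_eq_abs]
      refine (abs_cos_mul_exp_sub_one_le hl (hq i).1 (hq i).2).trans (le_of_eq (by ring))
    refine (Finset.sum_le_sum h1).trans ?_
    rw [Finset.sum_add_distrib, ← Finset.mul_sum, Finset.sum_const, Finset.card_range, nsmul_eq_mul]
    have h2 : ∑ i ∈ Finset.range n, (1 / 2 : ℝ) ^ i ≤ 2 := sum_geometric_two_le n
    nlinarith [sq_nonneg l]
  have h1 := (Finset.norm_prod_one_add_sub_one_le (Finset.range n) z).trans
    (sub_le_sub_right (Real.exp_le_exp.2 hsum) 1)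
  have h2 := norm_sawtoothCharFun_zero_sub_one_le (a := 2 - 2 * (1 / 2) ^ n) (l := l)
    (by rw [abs_le]; constructor <;> linarith [(hq n).1, (hq n).2]) hl
  rw [hprod]
  refine (norm_mul_one_add_sub_one_le h1 h2).trans (le_of_eq ?_)
  ring_nf

/-! ### Rescaling to the zone of control -/

theorem exp_sub_one_le_zone (l : ℝ) :
    Real.exp (l ^ 4 + 2 * l ^ 2) - 1 ≤ 3 * Real.exp 1 * l ^ 2 * Real.exp (3 * l ^ 4) := by
  have h1 : ∀ t : ℝ, Real.exp t - 1 ≤ t * Real.exp t := fun t => by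
    have := Real.add_one_le_exp (-t)
    have h2 : Real.exp (-t) * Real.exp t = 1 := by rw [← Real.exp_add]; simp
    nlinarith [Real.exp_pos t]
  -- Absorbs the quadratic exponent into the quartic one at the price of a factor `e`, the source of
  -- `K₁ = 3e`.
  have hsq : 2 * l ^ 2 ≤ 1 + l ^ 4 := by nlinarith [sq_nonneg (l ^ 2 - 1)]
  have h2 : l ^ 2 + 2 ≤ 3 * Real.exp (l ^ 4) := by
    have := Real.add_one_le_exp (l ^ 4)
    nlinarith [sq_nonneg (l ^ 2), sq_nonneg l]
  have h3 : Real.exp (l ^ 4 + 2 * l ^ 2) ≤ Real.exp (1 + 2 * l ^ 4) :=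
    Real.exp_le_exp.2 (by linarith)
  calc Real.exp (l ^ 4 + 2 * l ^ 2) - 1 ≤ l ^ 2 * (l ^ 2 + 2) * Real.exp (l ^ 4 + 2 * l ^ 2) := by
        refine (h1 _).trans (le_of_eq (by ring))
    _ ≤ l ^ 2 * (3 * Real.exp (l ^ 4)) * Real.exp (1 + 2 * l ^ 4) := by gcongr
    _ = 3 * Real.exp 1 * l ^ 2 * Real.exp (3 * l ^ 4) := by
        rw [Real.exp_add, show 3 * l ^ 4 = l ^ 4 + 2 * l ^ 4 by ring, Real.exp_add]; ring

theorem tendsto_sqrt_nat_div_four :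
    Tendsto (fun n : ℕ => Real.sqrt (n : ℝ) / 4) atTop atTop :=
  (Real.tendsto_sqrt_atTop.comp tendsto_natCast_atTop_atTop).atTop_div_const (by norm_num)

theorem hasZoneOfControl_sawtoothSum :
    HasZoneOfControl unitMeasure
      (fun (n : ℕ) (x : ℝ) => sawtoothSum n x / (n : ℝ) ^ (1 / 4 : ℝ))
      (fun n : ℕ => Real.sqrt (n : ℝ) / 4) (1 / 24) 2 4 := by
  refine ⟨tendsto_sqrt_nat_div_four, by norm_num, by norm_num, by norm_num, by norm_num,
    -- `K₂ = 3` comes from `exp_sub_one_le_zone`, and `D = 1/4` satisfies `D ^ 2 = 1/16 ≤ 1/12 = 1 /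
    -- (4 * K₂)`.
    1 / 4, 3 * Real.exp 1, 3, by norm_num, by positivity, by norm_num, by norm_num, ?_⟩
  intro n hn l hl
  have hn1 : (1 : ℝ) ≤ n := by exact_mod_cast hn
  have hn0 : (0 : ℝ) ≤ n := by linarith
  set r : ℝ := (n : ℝ) ^ (1 / 4 : ℝ) with hr
  have hr1 : 1 ≤ r := Real.one_le_rpow hn1 (by norm_num)
  have hr0 : 0 < r := by linarith
  have hr2 : Real.sqrt n = r ^ 2 := by
    rw [hr, Real.sqrt_eq_rpow, ← Real.rpow_natCast, ← Real.rpow_mul hn0]; norm_num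
  have hr4 : (n : ℝ) = r ^ 4 := by
    rw [hr, ← Real.rpow_natCast, ← Real.rpow_mul hn0]; norm_num
  -- The zone enters only through this inequality, which makes the estimate applicable at the
  -- frequency `l / r`.
  have hlr : |l| ≤ r := by
    refine hl.trans ?_
    have h1 : (Real.sqrt n / 4) ^ (1 / 24 : ℝ) ≤ r := by
      calc (Real.sqrt n / 4) ^ (1 / 24 : ℝ) ≤ (r ^ 2) ^ (1 / 24 : ℝ) := by
            rw [hr2]
            exact Real.rpow_le_rpow (by positivity) (by linarith [sq_nonneg r]) (by norm_num)
        _ ≤ (r ^ 2) ^ (1 / 2 : ℝ) :=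
            Real.rpow_le_rpow_of_exponent_le (one_le_pow₀ hr1) (by norm_num)
        _ = r := by rw [← Real.sqrt_eq_rpow, Real.sqrt_sq hr0.le]
    have : 0 ≤ (Real.sqrt n / 4) ^ (1 / 24 : ℝ) := by positivity
    linarith
  have hm : |l / r| ≤ 1 := by
    rw [abs_div, abs_of_pos hr0]; exact (div_le_one hr0).2 hlr
  have key := norm_sawtoothCharFun_mul_exp_sub_one_le n hm
  have e1 : (∫ x, Complex.exp (Complex.I * ((l * (sawtoothSum n x / r) : ℝ) : ℂ)) ∂unitMeasure) =
      sawtoothCharFun n 0 (l / r) := by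
    rw [integral_unitMeasure, sawtoothCharFun]
    refine intervalIntegral.integral_congr fun x _ => ?_
    have : l * (sawtoothSum n x / r) = l / r * (0 * sawtooth x + sawtoothSum n x) := by ring
    simp only [this]
  have e2 : Real.sqrt n / 4 * l ^ 2 / 2 = n * ((l / r) ^ 2 / 8) := by
    rw [hr2, hr4]; field_simp; ring
  have e3 : n * (l / r) ^ 4 = l ^ 4 := by rw [hr4]; field_simp
  have e4 : (l / r) ^ 2 ≤ l ^ 2 := sq_le_sq.2 (by
    rw [abs_div, abs_of_pos hr0]; exact div_le_self (abs_nonneg l) hr1)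
  rw [e1, e2]
  refine key.trans ?_
  have h2 : |l| ^ (2 : ℝ) = l ^ 2 := by
    rw [show (2 : ℝ) = (2 : ℕ) by norm_num, Real.rpow_natCast, sq_abs]
  have h4 : |l| ^ (4 : ℝ) = l ^ 4 := by
    rw [show (4 : ℝ) = (4 : ℕ) by norm_num, Real.rpow_natCast, Even.pow_abs (by decide)]
  rw [h2, h4, e3]
  refine le_trans ?_ (exp_sub_one_le_zone l)
  gcongr

/-! ### From intervals to Jordan measurable sets -/

/-- Serves both approximations of a Jordan measurable set: from inside with `U` its interior, from
outside with `K` its closure. -/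
theorem exists_finset_Ioc_between {K U : Set ℝ} (hK : IsCompact K) (hU : IsOpen U) (hKU : K ⊆ U) :
    ∃ T : Finset (Set ℝ), (∀ t ∈ T, ∃ a b : ℝ, t = Set.Ioc a b) ∧
      K ⊆ (⋃ t ∈ T, t) ∧ (⋃ t ∈ T, t) ⊆ U := by
  have h : ∀ x ∈ K, ∃ a b : ℝ, Set.Ioc a b ∈ 𝓝 x ∧ Set.Ioc a b ⊆ U := fun x hx => by
    obtain ⟨e, he, hb⟩ := Metric.isOpen_iff.1 hU x (hKU hx)
    refine ⟨x - e / 2, x + e / 2, Ioc_mem_nhds (by linarith) (by linarith), fun z hz => hb ?_⟩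
    rw [Metric.mem_ball, Real.dist_eq, abs_lt]
    constructor <;> linarith [hz.1, hz.2]
  choose! a b hab hU' using h
  obtain ⟨t, ht, hcov⟩ := hK.elim_nhds_subcover (fun x => Set.Ioc (a x) (b x)) hab
  classical
  refine ⟨t.image fun x => Set.Ioc (a x) (b x), ?_, ?_, ?_⟩
  · intro s hs
    obtain ⟨x, _, rfl⟩ := Finset.mem_image.1 hs
    exact ⟨_, _, rfl⟩
  · simpa using hcov
  · simpa using fun x hx => hU' x (ht x hx)

theorem isPiSystem_range_Ioc : IsPiSystem {t : Set ℝ | ∃ a b : ℝ, t = Set.Ioc a b} := by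
  rintro _ ⟨a, b, rfl⟩ _ ⟨c, d, rfl⟩ _
  exact ⟨_, _, Set.Ioc_inter_Ioc⟩

/-- If finite measures converge to Lebesgue measure on half-open intervals, they do so on Jordan
measurable sets. The set need not be Borel, so its mass is given by bounds from in- and outside. -/
theorem tendsto_of_tendsto_Ioc {μ : ℕ → Measure ℝ} [∀ n, IsFiniteMeasure (μ n)]
    (h : ∀ a b : ℝ, a ≤ b → Tendsto (fun n => (μ n).real (Set.Ioc a b)) atTop (𝓝 (b - a)))
    {B : Set ℝ} (hB : IsJordanMeasurable B) {q : ℕ → ℝ}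
    (hlo : ∀ᶠ n in atTop, ∀ E, MeasurableSet E → E ⊆ B → (μ n).real E ≤ q n)
    (hup : ∀ᶠ n in atTop, ∀ E, MeasurableSet E → B ⊆ E → q n ≤ (μ n).real E) :
    Tendsto q atTop (𝓝 (volume.real B)) := by
  obtain ⟨hbdd, hfr⟩ := hB
  have hfin : ∀ {s : Set ℝ}, s ⊆ closure B → volume s ≠ ⊤ := fun hs =>
    (Bornology.IsBounded.subset hbdd.closure hs).measure_lt_top.ne
  have hcl : volume (closure B) = volume B := measure_closure_of_null_frontier hfr
  have hint : volume (interior B) = volume B := measure_interior_of_null_frontier hfr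
  have hmeasT : ∀ T : Finset (Set ℝ), (∀ t ∈ T, ∃ a b : ℝ, t = Set.Ioc a b) →
      MeasurableSet (⋃ t ∈ T, t) := fun T hT =>
    Finset.measurableSet_biUnion T fun t ht => by
      obtain ⟨a, b, rfl⟩ := hT t ht; exact measurableSet_Ioc
  have hlim : ∀ T : Finset (Set ℝ), (∀ t ∈ T, ∃ a b : ℝ, t = Set.Ioc a b) →
      Tendsto (fun n => (μ n).real (⋃ t ∈ T, t)) atTop (𝓝 (volume.real (⋃ t ∈ T, t))) := by
    intro T hT
    -- The intervals may overlap; as they form a π-system, inclusion-exclusion passes convergence to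
    -- finite unions.
    refine isPiSystem_range_Ioc.tendsto_measureReal_biUnion hT ?_ ?_ ?_ ?_
    · rintro _ ⟨a, b, rfl⟩; exact measurableSet_Ioc
    · rintro _ ⟨a, b, rfl⟩
      rcases le_total a b with hab | hab
      · simpa [hab] using h a b hab
      · simp [Set.Ioc_eq_empty (not_lt.2 hab)]
    · rintro _ ⟨a, b, rfl⟩; simp
    · rintro _ ⟨a, b, rfl⟩ i; exact measure_ne_top _ _
  have hBfin : volume B ≠ ⊤ := hfin subset_closure
  refine tendsto_order.2 ⟨fun a ha => ?_, fun a ha => ?_⟩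
  · rcases lt_or_ge a 0 with ha0 | ha0
    · filter_upwards [hlo] with n hn
      have := hn ∅ MeasurableSet.empty (Set.empty_subset _)
      simp at this; linarith
    have ha' : ENNReal.ofReal a < volume (interior B) := by
      rw [hint]; exact (ENNReal.ofReal_lt_iff_lt_toReal ha0 hBfin).2 ha
    -- Inner regularity: the interior has full measure because the boundary is null.
    obtain ⟨K, hKB, hK, haK⟩ := isOpen_interior.exists_lt_isCompact ha'
    obtain ⟨T, hT, hKT, hTU⟩ := exists_finset_Ioc_between hK isOpen_interior hKB
    have hlt : a < volume.real (⋃ t ∈ T, t) :=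
      (ENNReal.ofReal_lt_iff_lt_toReal ha0 (hfin ((hTU.trans interior_subset).trans
        subset_closure))).1 (haK.trans_le (measure_mono hKT))
    filter_upwards [hlo, (tendsto_order.1 (hlim T hT)).1 a hlt] with n hn hn'
    exact hn'.trans_le (hn _ (hmeasT T hT) (hTU.trans interior_subset))
  · have ha' : volume (closure B) < ENNReal.ofReal a := by
      rw [hcl]; exact (ENNReal.lt_ofReal_iff_toReal_lt hBfin).2 ha
    obtain ⟨U, hBU, hU, hUa⟩ := Set.exists_isOpen_lt_of_lt _ _ ha'
    have hKc : IsCompact (closure B) := hbdd.isCompact_closure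
    obtain ⟨T, hT, hKT, hTU⟩ := exists_finset_Ioc_between hKc hU hBU
    have hlt0 : volume (⋃ t ∈ T, t) < ENNReal.ofReal a := (measure_mono hTU).trans_lt hUa
    have hlt : volume.real (⋃ t ∈ T, t) < a :=
      (ENNReal.lt_ofReal_iff_toReal_lt hlt0.ne_top).1 hlt0
    filter_upwards [hup, (tendsto_order.1 (hlim T hT)).2 a hlt] with n hn hn'
    exact (hn _ (hmeasT T hT) (subset_closure.trans hKT)).trans_lt hn'

/-! ### The local limit theorem -/

theorem tendsto_four_div_sqrt : Tendsto (fun n : ℕ => 4 / Real.sqrt (n : ℝ)) atTop (𝓝 0) :=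
  tendsto_const_nhds.div_atTop (Real.tendsto_sqrt_atTop.comp tendsto_natCast_atTop_atTop)

/-- The derivative of `t ↦ normalCDF (y + t * a)` at `0`, read along `h n`. -/
theorem tendsto_normalCDF_slope (y a : ℝ) {h : ℕ → ℝ} (h0 : Tendsto h atTop (𝓝 0))
    (hpos : ∀ᶠ n in atTop, 0 < h n) :
    Tendsto (fun n => (normalCDF (y + h n * a) - normalCDF y) / h n) atTop
      (𝓝 (normalDensity y * a)) := by
  have hd : HasDerivAt (fun t => normalCDF (y + t * a)) (normalDensity y * a) 0 := by
    have h1 : HasDerivAt (fun t : ℝ => y + t * a) a 0 := by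
      simpa using ((hasDerivAt_id (0 : ℝ)).mul_const a).const_add y
    have h2 : HasDerivAt normalCDF (normalDensity y) (y + 0 * a) := by
      simpa using hasDerivAt_normalCDF y
    exact h2.comp 0 h1
  have := (hasDerivAt_iff_tendsto_slope_zero.1 hd).comp (tendsto_nhdsWithin_iff.2
    ⟨h0, hpos.mono fun n hn => hn.ne'⟩)
  refine this.congr fun n => ?_
  simp [div_eq_inv_mul]

theorem unitMeasure_real_eq (s : Set ℝ) :
    unitMeasure.real s = volume.real {x : ℝ | x ∈ Set.Icc (0 : ℝ) 1 ∧ x ∈ s} := by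
  rw [measureReal_def, unitMeasure, Measure.restrict_apply' measurableSet_Icc, Set.inter_comm]
  rfl

/-- A local limit theorem in windows of size `h n` follows from a Kolmogorov bound of smaller
order. -/
theorem tendsto_window_Ioc {Y : ℕ → ℝ → ℝ} (hY : ∀ n, Measurable (Y n)) {e h : ℕ → ℝ}
    (hcdf : ∀ᶠ n in atTop, ∀ s, |unitMeasure.real {x | Y n x ≤ s} - normalCDF s| ≤ e n)
    (h0 : Tendsto h atTop (𝓝 0)) (hpos : ∀ᶠ n in atTop, 0 < h n)
    (he : Tendsto (fun n => e n / h n) atTop (𝓝 0)) (y a b : ℝ) (hab : a ≤ b) :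
    Tendsto (fun n => unitMeasure.real {x | (Y n x - y) / h n ∈ Set.Ioc a b} / h n) atTop
      (𝓝 (normalDensity y * (b - a))) := by
  have hmain : Tendsto (fun n => (normalCDF (y + h n * b) - normalCDF (y + h n * a)) / h n) atTop
      (𝓝 (normalDensity y * (b - a))) := by
    have := (tendsto_normalCDF_slope y b h0 hpos).sub (tendsto_normalCDF_slope y a h0 hpos)
    rw [← mul_sub] at this
    exact this.congr fun n => by ring
  refine tendsto_of_tendsto_of_dist hmain ?_
  refine squeeze_zero' (Eventually.of_forall fun _ => dist_nonneg) ?_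
    (by simpa using he.const_mul 2 : Tendsto (fun n => 2 * (e n / h n)) atTop (𝓝 0))
  filter_upwards [hcdf, hpos] with n hn hp
  have hset : {x | (Y n x - y) / h n ∈ Set.Ioc a b} =
      {x | Y n x ≤ y + h n * b} \ {x | Y n x ≤ y + h n * a} := by
    ext x
    simp only [Set.mem_ofPred_eq, Set.mem_Ioc, Set.mem_sdiff, not_le, lt_div_iff₀ hp,
      div_le_iff₀ hp]
    constructor <;> rintro ⟨h1, h2⟩ <;> constructor <;> linarith
  have hsub : {x | Y n x ≤ y + h n * a} ⊆ {x | Y n x ≤ y + h n * b} := fun x hx => by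
    simp only [Set.mem_ofPred_eq] at hx ⊢
    exact hx.trans (by gcongr)
  rw [hset, measureReal_sdiff hsub (measurableSet_le (hY n) measurable_const), Real.dist_eq,
    ← sub_div, abs_div, abs_of_pos hp, ← mul_div_assoc]
  gcongr
  have h1 := abs_le.1 (hn (y + h n * a))
  have h2 := abs_le.1 (hn (y + h n * b))
  rw [abs_le]; constructor <;> linarith

theorem localLimit_sawtoothSum (y : ℝ) {B : Set ℝ} (hB : IsJordanMeasurable B) {δ : ℝ}
    (hδ : 0 < δ) (hδ1 : δ < 1) :
    Tendsto (fun n : ℕ => (Real.sqrt (n : ℝ) / 4) ^ δ *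
      volume.real {x : ℝ | x ∈ Set.Icc (0 : ℝ) 1 ∧
        2 * sawtoothSum n x / Real.sqrt (n : ℝ) - y ∈ ((4 / Real.sqrt (n : ℝ)) ^ δ) • B})
      atTop (𝓝 (Real.exp (-y ^ 2 / 2) * volume.real B / Real.sqrt (2 * Real.pi))) := by
  set Y : ℕ → ℝ → ℝ := fun n x => 2 * sawtoothSum n x / Real.sqrt (n : ℝ) with hYdef
  set u : ℕ → ℝ := fun n => 4 / Real.sqrt (n : ℝ) with hu
  set h : ℕ → ℝ := fun n => u n ^ δ with hh
  have hY : ∀ n, Measurable (Y n) := fun n => by fun_prop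
  have hu0 : Tendsto u atTop (𝓝 0) := tendsto_four_div_sqrt
  have hupos : ∀ᶠ n in atTop, 0 < u n := by
    filter_upwards [eventually_ge_atTop 1] with n hn
    have : (0 : ℝ) < n := by exact_mod_cast hn
    simp only [hu]; positivity
  have hpos : ∀ᶠ n in atTop, 0 < h n := hupos.mono fun n hn => Real.rpow_pos_of_pos hn δ
  have hpow : ∀ s : ℝ, 0 < s → Tendsto (fun n => u n ^ s) atTop (𝓝 0) := fun s hs => by
    have := hu0.rpow_const (p := s) (Or.inr hs.le)
    rwa [Real.zero_rpow hs.ne'] at this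
  obtain ⟨K, -, hK⟩ := exists_abs_sawtoothSum_cdf_sub_le
  have hcdf : ∀ᶠ n in atTop, ∀ s, |unitMeasure.real {x | Y n x ≤ s} - normalCDF s| ≤ K * u n := by
    filter_upwards [eventually_ge_atTop 1] with n hn s using hK n hn s
  -- The ratio is `K * u ^ (1 - δ)`; this is where `δ < 1` matters.
  have he : Tendsto (fun n => K * u n / h n) atTop (𝓝 0) := by
    have := (hpow (1 - δ) (by linarith)).const_mul K
    rw [mul_zero] at this
    refine this.congr' ?_
    filter_upwards [hupos] with n hn
    rw [Real.rpow_sub hn, Real.rpow_one, mul_div_assoc]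
  have hφ : 0 < normalDensity y := normalDensity_pos y
  -- The blown-up law of `Y n` around `y`, divided by the limiting density so that the limit is
  -- Lebesgue measure.
  set μ : ℕ → Measure ℝ := fun n => ENNReal.ofReal ((h n * normalDensity y)⁻¹) •
    unitMeasure.map (fun x => (Y n x - y) / h n) with hμ
  have hVm : ∀ n, Measurable (fun x => (Y n x - y) / h n) := fun n => by fun_prop
  have hμfin : ∀ n, IsFiniteMeasure (μ n) := fun n => by
    simp only [hμ]
    exact Measure.smul_finite _ ENNReal.ofReal_ne_top
  have hμreal : ∀ᶠ n in atTop, ∀ E, MeasurableSet E → (μ n).real E =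
      unitMeasure.real {x | (Y n x - y) / h n ∈ E} / h n / normalDensity y := by
    filter_upwards [hpos] with n hn E hE
    rw [hμ, measureReal_ennreal_smul_apply, map_measureReal_apply (hVm n) hE,
      ENNReal.toReal_ofReal (by positivity)]
    rw [mul_inv, div_div, div_eq_inv_mul, mul_inv]
    rfl
  have hIoc : ∀ a b : ℝ, a ≤ b →
      Tendsto (fun n => (μ n).real (Set.Ioc a b)) atTop (𝓝 (b - a)) := fun a b hab => by
    have := (tendsto_window_Ioc hY hcdf (hpow δ hδ) hpos he y a b hab).div_const (normalDensity y)
    rw [mul_div_cancel_left₀ _ hφ.ne'] at this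
    refine this.congr' ?_
    filter_upwards [hμreal] with n hn
    rw [hn _ measurableSet_Ioc]
  -- As `B` need not be Borel, the mass of its preimage is an outer measure, compared with Borel
  -- sets through monotonicity alone.
  have hq := tendsto_of_tendsto_Ioc hIoc hB
    (q := fun n => unitMeasure.real {x | (Y n x - y) / h n ∈ B} / h n / normalDensity y)
    (by
      filter_upwards [hμreal, hpos] with n hn hp E hE hEB
      rw [hn E hE]
      gcongr
      exact measure_ne_top _ _)
    (by
      filter_upwards [hμreal, hpos] with n hn hp E hE hEB
      rw [hn E hE]
      gcongr
      exact measure_ne_top _ _)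
  have hfin := hq.const_mul (normalDensity y)
  have hconst : normalDensity y * volume.real B =
      Real.exp (-y ^ 2 / 2) * volume.real B / Real.sqrt (2 * Real.pi) := by
    unfold normalDensity; ring
  rw [hconst] at hfin
  refine hfin.congr' ?_
  filter_upwards [hpos, hupos] with n hn hun
  rw [mul_div_cancel₀ _ hφ.ne', unitMeasure_real_eq, div_eq_inv_mul]
  congr 1
  · simp only [hh, hu]
    rw [← Real.inv_rpow hun.le, inv_div]
  · congr 1
    ext x
    simp only [Set.mem_ofPred_eq]
    rw [Set.mem_smul_set_iff_inv_smul_mem₀ hn.ne', smul_eq_mul, div_eq_inv_mul]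

theorem mainTheorem11 :
    (∀ (y : ℝ) (B : Set ℝ), IsJordanMeasurable B → 0 < volume B →
      ∀ δ : ℝ, 0 < δ → δ < 13 / 24 →
        Tendsto
          (fun n : ℕ => (Real.sqrt (n : ℝ) / 4) ^ δ *
            volume.real {x : ℝ | x ∈ Set.Icc (0 : ℝ) 1 ∧
              2 * sawtoothSum n x / Real.sqrt (n : ℝ) - y ∈ ((4 / Real.sqrt (n : ℝ)) ^ δ) • B})
          atTop
          (𝓝 (Real.exp (-y ^ 2 / 2) * volume.real B / Real.sqrt (2 * Real.pi)))) ∧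
    (∃ C : ℝ, 0 < C ∧ ∀ n : ℕ, 1 ≤ n →
      kolmogorovDist
          (unitMeasure.map (fun x : ℝ => 2 * sawtoothSum n x / Real.sqrt (n : ℝ)))
          (gaussianReal 0 1)
        ≤ C * (4 / Real.sqrt (n : ℝ)) ^ (13 / 24 : ℝ)) ∧
    HasZoneOfControl unitMeasure
      (fun (n : ℕ) (x : ℝ) => sawtoothSum n x / (n : ℝ) ^ (1 / 4 : ℝ))
      (fun n : ℕ => Real.sqrt (n : ℝ) / 4) (1 / 24) 2 4 :=
  ⟨fun y _ hB _ _ hδ hδ1 => localLimit_sawtoothSum y hB hδ (by linarith),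
    exists_kolmogorovDist_sawtoothSum_le, hasZoneOfControl_sawtoothSum⟩
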